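/- **Setting.** Consider a discounted Markov decision process with finite state space $\mathcal S$, action space $\mathcal A\subseteq\mathbb R^N$ (such that gradients of functions on $\mathcal A$ are uniquely determined at every point of $\mathcal A$, e.g. $\mathcal A$ open, or convex with nonempty interior), transition probabilities $p(s'\mid s,a)$, rewards $r(s,a)\in[0,1]$ and discount factor $\gamma\in(0,1)$. For every state $s$ let $\mathcal C(s)\subseteq\mathcal A$ be a compact convex set of feasible actions, $D_s$ its Euclidean diameter, and $D_{\max}=\max_s D_s$. For a deterministic policy $\pi:\mathcal S\to\mathcal A$ let $$V(s;\pi)=\mathbb E\Big[\sum_{t\ge0}\gamma^t r(s_t,a_t)\,\Big|\,s_0=s,\pi\Big],\qquad Q(s,a;\pi)=\mathbb E\Big[\sum_{t\ge0}\gamma^t r(s_t,a_t)\,\Big|\,s_0=s,a_0=a,\pi\Big],$$ and $J_\mu(\pi)=\sum_s\mu(s)V(s;\pi)$ for a probability distribution $\mu$ on $\mathcal S$. Policies are parametrized directly, $\pi(s;\theta)=\theta(s)$. Assume: * for every $s$, the map $a\mapsto r(s,a)$ is differentiable on $\mathcal A$ with $L_r$-Lipschitz gradient; * for all $s,s'$,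 the map $a\mapsto p(s'\mid s,a)$ is twice differentiable on $\mathcal A$ with $L_p$-Lipschitz gradient, and $\sup_{s,a,s'}\|\nabla_a p(s'\mid s,a)\|_2<C_p$. Call $L$ a *smoothness constant* for $\mu$ if $\theta\mapsto J_\mu(\pi(\cdot;\theta))$, defined for $\theta\in\mathcal A^{\mathcal S}$, is differentiable and its gradient is $L$-Lipschitz (in the Euclidean norm) on the set $\prod_s\mathcal C(s)$ of feasible parameters. **Algorithm (FWPO).** Let $\mu(s)>0$ for all $s$, $\mu_{\min}=\min_s\mu(s)$ and $L>0$. Start from $\theta_0$ with $\theta_0(s)\in\mathcal C(s)$ for all $s$. For $k=0,1,\dots$ and every $s$ choose $$c_k(s)\in\operatorname*{arg\,max}_{c\in\mathcal C(s)}\big\langle c,\nabla_aQ(s,a;\theta_k)|_{a=\theta_k(s)}\big\rangle,\qquad g_k(s)=\big\langle c_k(s)-\theta_k(s),\nabla_aQ(s,a;\theta_k)|_{a=\theta_k(s)}\big\rangle,$$ $$\alpha_k(s)=\frac{(1-\gamma)\mu_{\min}}{L D_s^2}\,g_k(s),\qquad \theta_{k+1}(s)=\theta_k(s)+\alpha_k(s)\,(c_k(s)-\theta_k(s)),$$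 with $\alpha_k(s)=0$ if $D_s=0$. Let $\mathcal G_k=\big(\sum_s g_k(s)^2\big)^{1/2}$ and $\bar{\mathcal G}_T=\min_{0\le k\le T}\mathcal G_k$. The run is *feasible* if $\theta_k(s)\in\mathcal C(s)$ for all $k$ and $s$. **Proposition.** 1. There is $L_0>0$, depending only on the decision process and the sets $\mathcal C(s)$, such that every $L\ge L_0$ is a smoothness constant for every $\mu$, and every run of FWPO with such an $L$ (for any $\mu$ with $\mu(s)>0$ for all $s$) is feasible. 2. Let $\mu(s)>0$ for all $s$, and let $L>0$ be any smoothness constant for $\mu$. For every feasible run of FWPO with this $L$ (in particular, every run if $L\ge L_0$): * $V(s;\pi(\cdot;\theta_{k+1}))\ge V(s;\pi(\cdot;\theta_k))$ for all $k$ and all states $s$; * $\mathcal G_k\to0$ as $k\to\infty$, and $$\sum_{k=0}^\infty\mathcal G_k^2\le\frac{2LD_{\max}^2}{(1-\gamma)^3\mu_{\min}^2};$$ * consequently, for every $T\ge 0$, $$\bar{\mathcal G}_T\le\sqrt{\frac1{T+1}\cdot\frac{2LD_{\max}^2}{(1-\gamma)^3\mu_{\min}^2}},\qquad\text{so}\quad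 \bar{\mathcal G}_T=O(T^{-1/2}).$$ -/

import Mathlib

open Filter Topology MeasureTheory ProbabilityTheory Asymptotics

noncomputable section

namespace FWPO

/-- The Euclidean space `ℝ^N` that contains the actions. -/
abbrev ActionVec (N : ℕ) : Type := EuclideanSpace ℝ (Fin N)

/-- The Euclidean (Frobenius) space of tabular parameters: one vector of `ℝ^N` per state. -/
abbrev Param (S : Type*) (N : ℕ) : Type _ := PiLp 2 (fun _ : S => ActionVec N)

/-- Discounted MDP with state space `S` and action space `actions ⊆ ℝ^N`. Transition probabilities
and rewards are total functions of the action, but only their values at actions in `actions` carry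
meaning: outside they are arbitrary. `uniqueDiff` says that the action space is
such that gradients with respect to the action are well defined on it (it holds for instance for
open sets, and for convex sets with nonempty interior). -/
structure MDP (S : Type*) (N : ℕ) where
  actions : Set (ActionVec N)
  uniqueDiff : UniqueDiffOn ℝ actions
  trans : S → ActionVec N → PMF S
  reward : S → ActionVec N → ℝ
  reward_mem : ∀ s, ∀ a ∈ actions, reward s a ∈ Set.Icc (0 : ℝ) 1
  γ : ℝ
  γ_mem : γ ∈ Set.Ioo (0 : ℝ) 1

/-- `f` (of which only the values on `dom` matter) is differentiable on `dom`, and its gradient is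
`L`-Lipschitz on `X ⊆ dom`. With `X = dom` this is the usual `L`-smoothness of `f : dom → ℝ`. -/
def IsSmoothOn {F : Type*} [NormedAddCommGroup F] [InnerProductSpace ℝ F] [CompleteSpace F]
    (L : ℝ) (f : F → ℝ) (dom X : Set F) : Prop :=
  DifferentiableOn ℝ f dom ∧
    ∀ x ∈ X, ∀ y ∈ X, ‖gradientWithin f dom x - gradientWithin f dom y‖ ≤ L * ‖x - y‖

namespace MDP

variable {S : Type*} {N : ℕ} (M : MDP S N)

/-- The real number `p(s' | s, a)`. -/
def prob (s : S) (a : ActionVec N) (s' : S) : ℝ := (M.trans s a s').toReal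

/-- The regularity assumptions on rewards and transition probabilities, with their constants. -/
structure Regular (Lr Lp Cp : ℝ) : Prop where
  Lr_nonneg : 0 ≤ Lr
  Lp_nonneg : 0 ≤ Lp
  reward_smooth : ∀ s, IsSmoothOn Lr (M.reward s) M.actions M.actions
  prob_smooth : ∀ s s', IsSmoothOn Lp (fun a => M.prob s a s') M.actions M.actions
  prob_twice : ∀ s s', DifferentiableOn ℝ
    (gradientWithin (fun a => M.prob s a s') M.actions) M.actions
  prob_grad : ∃ b < Cp, ∀ s s', ∀ a ∈ M.actions,
    ‖gradientWithin (fun a => M.prob s a s') M.actions a‖ ≤ b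

variable [Fintype S] [MeasurableSpace S] [DiscreteMeasurableSpace S]

/-- Law of `s_{t+1}` given the history `s_0, …, s_t`, when action `σ t s_t` is taken at time `t`. -/
def stepKernel (σ : ℕ → S → ActionVec N) (t : ℕ) :
    Kernel ((i : Finset.Iic t) → (fun _ : ℕ => S) i) S :=
  (Kernel.ofFunOfCountable fun s => (M.trans s (σ t s)).toMeasure).comap
    (fun h => h ⟨t, Finset.mem_Iic.2 le_rfl⟩) (measurable_pi_apply _)

instance (σ : ℕ → S → ActionVec N) (t : ℕ) : IsMarkovKernel (M.stepKernel σ t) := by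
  unfold stepKernel
  have : IsMarkovKernel (Kernel.ofFunOfCountable fun s => (M.trans s (σ t s)).toMeasure) :=
    ⟨fun s => by
      change IsProbabilityMeasure (M.trans s (σ t s)).toMeasure
      infer_instance⟩
  infer_instance

/-- Law of the state trajectory `(s_0, s_1, …)` started at `s_0 = s`, when action `σ t s_t` is taken
at each time `t`. -/
def trajLaw (σ : ℕ → S → ActionVec N) (s : S) : Measure (ℕ → S) :=
  Kernel.traj (X := fun _ : ℕ => S) (M.stepKernel σ) 0 (fun _ => s)

/-- `E[∑ₜ γ^t r(s_t, a_t) | s_0 = s]` with `a_t = σ t s_t`. -/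
def expReturn (σ : ℕ → S → ActionVec N) (s : S) : ℝ :=
  ∫ ω, ∑' t : ℕ, M.γ ^ t * M.reward (ω t) (σ t (ω t)) ∂(M.trajLaw σ s)

/-- The state value function `V(s; π)`. -/
def V (π : S → ActionVec N) (s : S) : ℝ := M.expReturn (fun _ => π) s

/-- The action value function `Q(s, a; π)`: the action at time `0` is `a`, afterwards `π` is
followed. -/
def Q (π : S → ActionVec N) (s : S) (a : ActionVec N) : ℝ :=
  M.expReturn (fun t s' => if t = 0 then a else π s') s

/-- The gradient of `a ↦ Q(s, a; π)` at `a = π(s)`. -/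
def gradQ (π : S → ActionVec N) (s : S) : ActionVec N :=
  gradientWithin (M.Q π s) M.actions (π s)

/-- The performance objective `J_μ(π)`, the mean of `V(s; π)` over `s ∼ μ`. -/
def J (μ : S → ℝ) (π : S → ActionVec N) : ℝ := ∑ s, μ s * M.V π s

/-- `θ ↦ J_μ(π(·; θ))`, as a function on parameters with values in the action space, has an
`L`-Lipschitz gradient on the feasible parameters. -/
def JSmooth (C : S → Set (ActionVec N)) (μ : S → ℝ) (L : ℝ) : Prop :=
  IsSmoothOn L (fun θ : Param S N => M.J μ (fun s => θ s))
    {θ | ∀ s, θ s ∈ M.actions} {θ | ∀ s, θ s ∈ C s}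

/-- The state-wise Frank–Wolfe gap at policy `π`, with Frank–Wolfe vertices `c`. -/
def gap (π c : S → ActionVec N) (s : S) : ℝ := inner ℝ (c s - π s) (M.gradQ π s)

/-- The effective Frank–Wolfe gap. -/
def effGap (π c : S → ActionVec N) : ℝ := √(∑ s, M.gap π c s ^ 2)

/-- The learning rate `(1-γ) μ_min g(s) / (L D_s²)`. -/
def stepSize (C : S → Set (ActionVec N)) (μ : S → ℝ) (L : ℝ) (π c : S → ActionVec N) (s : S) : ℝ :=
  (1 - M.γ) * (⨅ s', μ s') / (L * Metric.diam (C s) ^ 2) * M.gap π c s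

/-- `θ` and `c` are the policies and the Frank–Wolfe vertices of a run of FWPO with smoothness
constant `L` (the maximizer in the direction step may be any one). -/
structure IsRun (C : S → Set (ActionVec N)) (μ : S → ℝ) (L : ℝ)
    (θ c : ℕ → S → ActionVec N) : Prop where
  init : ∀ s, θ 0 s ∈ C s
  vertex_mem : ∀ k s, c k s ∈ C s
  vertex_max : ∀ k s, ∀ z ∈ C s,
    inner ℝ z (M.gradQ (θ k) s) ≤ inner ℝ (c k s) (M.gradQ (θ k) s)
  update : ∀ k s, θ (k + 1) s = θ k s + M.stepSize C μ L (θ k) (c k) s • (c k s - θ k s)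

end MDP

/-- A restarting state distribution that charges every state. -/
def IsPosDistribution {S : Type*} [Fintype S] (μ : S → ℝ) : Prop :=
  μ ∈ stdSimplex ℝ S ∧ ∀ s, 0 < μ s

/-- The running minimum `min_{0 ≤ k ≤ T} G k`. -/
def runMin (G : ℕ → ℝ) (T : ℕ) : ℝ :=
  (Finset.range (T + 1)).inf' Finset.nonempty_range_add_one G

end FWPO

end

/-! Everything rests on the performance difference identity `V_sub_V`: the change of value from `π`
to `π'` is the occupancy of `π'` summed against the advantages `Q π s (π' s) - V π s`. It follows
from the Bellman equations, since `1 - γ P` is invertible and its inverse `occ` has nonnegative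
entries, diagonal at least `1` and row sums `1 / (1 - γ)`. The identity also gives the policy
gradient without differentiating occupancies: the advantages vanish at `π' = π`, so continuity of
the occupancy suffices, and the gradient of `J` has blocks `stateOcc • gradQ`. These are built by
sums and products from functions that are bounded and Lipschitz on the feasible set, whence a
smoothness constant common to all `μ`. With a smoothness constant, the quadratic lower bound for `J`
splits into one term per state (`J_lower_bound`). The step size makes the quadratic loss at most
half of the first-order gain, so each term is nonnegative and controls the squared gap
(`step_gain`). For monotonicity of values, the update is applied in one state only. Then `J` does
not decrease, and the performance difference has a single term with positive occupancy, so the new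
action has nonnegative advantage (`V_le_Q_step`). Having this in every state, the identity for the
full update gives improvement in every state. Summability of the squared gaps comes from telescoping
`J`, which lies in `[0, 1 / (1 - γ)]`. -/

noncomputable section

namespace FWPO.MDP

/-! ### State marginals of the trajectory law -/

section Trajectory

variable {S : Type*} {N : ℕ} (M : MDP S N)

lemma prob_nonneg (s : S) (a : ActionVec N) (s' : S) : 0 ≤ M.prob s a s' :=
  ENNReal.toReal_nonneg

variable [Fintype S]

lemma sum_prob (s : S) (a : ActionVec N) : ∑ s', M.prob s a s' = 1 := by
  unfold prob
  rw [← ENNReal.toReal_sum fun s' _ => (M.trans s a).apply_ne_top s',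
    ← tsum_fintype (L := .unconditional S),
    (M.trans s a).tsum_coe, ENNReal.toReal_one]

variable [MeasurableSpace S] [DiscreteMeasurableSpace S]

instance (σ : ℕ → S → ActionVec N) (s : S) : IsProbabilityMeasure (M.trajLaw σ s) := by
  unfold trajLaw
  infer_instance

/-- The probability of being in state `x` at time `t`. -/
def stateProb (σ : ℕ → S → ActionVec N) (s : S) (t : ℕ) (x : S) : ℝ :=
  (M.trajLaw σ s).real {ω | ω t = x}

open Classical in
lemma stateProb_zero (σ : ℕ → S → ActionVec N) (s x : S) :
    M.stateProb σ s 0 x = if s = x then 1 else 0 := by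
  have h := Kernel.traj_map_frestrictLe_apply (X := fun _ : ℕ => S) (κ := M.stepKernel σ) 0 0
    (fun _ => s)
  rw [Kernel.partialTraj_self, Kernel.id_apply] at h
  have h2 : M.trajLaw σ s {ω | ω 0 = x} = if s = x then 1 else 0 := by
    have hs : MeasurableSet {y : (i : Finset.Iic 0) → (fun _ : ℕ => S) i |
        y ⟨0, Finset.mem_Iic.2 le_rfl⟩ = x} :=
      measurable_pi_apply (X := fun _ : Finset.Iic 0 => S) _ (measurableSet_singleton x)
    have h3 := congrArg (fun m => m {y : (i : Finset.Iic 0) → (fun _ : ℕ => S) i |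
      y ⟨0, Finset.mem_Iic.2 le_rfl⟩ = x}) h
    beta_reduce at h3
    rw [Measure.map_apply (Preorder.measurable_frestrictLe 0) hs, Measure.dirac_apply' _ hs] at h3
    refine h3.trans ?_
    simp [Set.indicator_apply]
  rw [stateProb, measureReal_def, h2]
  split_ifs <;> simp

/-- Disintegrate the trajectory law at time `t`: given the history, the next state is drawn from
`stepKernel`, which sees only the state at time `t`. -/
lemma stateProb_succ (σ : ℕ → S → ActionVec N) (s : S) (t : ℕ) (y : S) :
    M.stateProb σ s (t + 1) y = ∑ x, M.stateProb σ s t x * M.prob x (σ t x) y := by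
  have hy : MeasurableSet {ω : ℕ → S | ω (t + 1) = y} :=
    measurable_pi_apply (X := fun _ : ℕ => S) (t + 1) (measurableSet_singleton y)
  have hstep : ∀ h : (i : Finset.Iic t) → (fun _ : ℕ => S) i,
      Kernel.traj (M.stepKernel σ) t h {ω : ℕ → S | ω (t + 1) = y} =
        M.trans (h ⟨t, Finset.mem_Iic.2 le_rfl⟩) (σ t (h ⟨t, Finset.mem_Iic.2 le_rfl⟩)) y := by
    intro h
    have h1 := Kernel.map_traj_succ_self (X := fun _ : ℕ => S) (κ := M.stepKernel σ) (a := t)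
    have h2 := congrArg (fun k => k h {y}) h1
    beta_reduce at h2
    rw [Kernel.map_apply' _ (measurable_pi_apply _) _ (measurableSet_singleton y)] at h2
    refine h2.trans ?_
    change (M.trans _ _).toMeasure {y} = _
    rw [PMF.toMeasure_apply_singleton _ _ (measurableSet_singleton y)]
  have key : M.trajLaw σ s {ω | ω (t + 1) = y} =
      ∑ x, M.trajLaw σ s {ω | ω t = x} * M.trans x (σ t x) y := by
    have h1 : M.trajLaw σ s {ω | ω (t + 1) = y} =
        ∫⁻ ω, M.trans (ω t) (σ t (ω t)) y ∂(M.trajLaw σ s) := by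
      have hc := Kernel.traj_comp_partialTraj (X := fun _ : ℕ => S) (κ := M.stepKernel σ)
        (Nat.zero_le t)
      have h2 := congrArg (fun k => k (fun _ => s) {ω : ℕ → S | ω (t + 1) = y}) hc
      beta_reduce at h2
      rw [Kernel.comp_apply' _ _ _ hy] at h2
      refine h2.symm.trans ?_
      simp_rw [hstep]
      rw [← Kernel.traj_map_frestrictLe_apply, lintegral_map _ (Preorder.measurable_frestrictLe t)]
      · rfl
      · exact (Measurable.of_discrete (f := fun x => M.trans x (σ t x) y)).comp
          (measurable_pi_apply (X := fun _ : Finset.Iic t => S) _)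
    rw [h1]
    have h3 := lintegral_map (μ := M.trajLaw σ s) (f := fun x => M.trans x (σ t x) y)
      (g := fun ω : ℕ → S => ω t) .of_discrete (measurable_pi_apply _)
    rw [← h3, lintegral_fintype]
    refine Finset.sum_congr rfl fun x _ => ?_
    rw [mul_comm, Measure.map_apply (measurable_pi_apply _) (measurableSet_singleton x)]
    rfl
  simp only [stateProb, measureReal_def, key, prob]
  rw [ENNReal.toReal_sum]
  · simp
  · exact fun x _ => ENNReal.mul_ne_top (measure_ne_top _ _) ((M.trans _ _).apply_ne_top _)

lemma integral_eval (σ : ℕ → S → ActionVec N) (s : S) (t : ℕ) (f : S → ℝ) :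
    ∫ ω, f (ω t) ∂(M.trajLaw σ s) = ∑ x, M.stateProb σ s t x * f x := by
  have h := integral_map (μ := M.trajLaw σ s) (φ := fun ω : ℕ → S => ω t) (f := f)
    (measurable_pi_apply t).aemeasurable (Measurable.of_discrete.aestronglyMeasurable)
  have : IsProbabilityMeasure ((M.trajLaw σ s).map (fun ω : ℕ → S => ω t)) :=
    Measure.isProbabilityMeasure_map (measurable_pi_apply t).aemeasurable
  rw [← h, integral_fintype .of_finite]
  refine Finset.sum_congr rfl fun x _ => ?_
  rw [stateProb, map_measureReal_apply (measurable_pi_apply t) (measurableSet_singleton x)]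
  rfl

/-- A geometric majorant permits exchanging sum and expectation; afterwards only the state marginals
matter. -/
lemma expReturn_hasSum (σ : ℕ → S → ActionVec N) (s : S) {B : ℝ}
    (hB : ∀ t x, |M.reward x (σ t x)| ≤ B) :
    HasSum (fun t => M.γ ^ t * ∑ x, M.stateProb σ s t x * M.reward x (σ t x))
      (M.expReturn σ s) := by
  have hγ := M.γ_mem
  have hm : ∀ t, Measurable fun ω : ℕ → S => M.γ ^ t * M.reward (ω t) (σ t (ω t)) := fun t =>
    ((Measurable.of_discrete (f := fun x => M.reward x (σ t x))).comp
      (measurable_pi_apply t)).const_mul _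
  have hb : ∀ t (ω : ℕ → S), ‖M.γ ^ t * M.reward (ω t) (σ t (ω t))‖ ≤ M.γ ^ t * B := by
    intro t ω
    rw [norm_mul, norm_pow, Real.norm_eq_abs, Real.norm_eq_abs, abs_of_pos hγ.1]
    exact mul_le_mul_of_nonneg_left (hB t _) (pow_nonneg hγ.1.le _)
  have hi : ∀ t, Integrable (fun ω : ℕ → S => M.γ ^ t * M.reward (ω t) (σ t (ω t)))
      (M.trajLaw σ s) := fun t =>
    .of_bound (hm t).aestronglyMeasurable (M.γ ^ t * B) (.of_forall (hb t))
  have hs : Summable fun t => M.γ ^ t * B :=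
    (summable_geometric_of_lt_one hγ.1.le hγ.2).mul_right B
  have hsum : Summable fun t => ∫ ω, ‖M.γ ^ t * M.reward (ω t) (σ t (ω t))‖ ∂(M.trajLaw σ s) := by
    refine hs.of_nonneg_of_le (fun t => integral_nonneg fun _ => norm_nonneg _) fun t => ?_
    refine (integral_mono (hi t).norm (integrable_const _) (hb t)).trans ?_
    simp
  have h := hasSum_integral_of_summable_integral_norm hi hsum
  have ht : ∀ t, ∫ ω, M.γ ^ t * M.reward (ω t) (σ t (ω t)) ∂(M.trajLaw σ s) =
      M.γ ^ t * ∑ x, M.stateProb σ s t x * M.reward x (σ t x) := fun t => by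
    rw [integral_const_mul, M.integral_eval σ s t fun x => M.reward x (σ t x)]
  simp_rw [ht] at h
  exact h

end Trajectory

/-! ### Bellman equations -/

section Bellman

open Matrix

open scoped Classical

variable {S : Type*} {N : ℕ} (M : MDP S N) [Fintype S]

/-- The transition matrix of a policy. -/
def transMatrix (π : S → ActionVec N) : Matrix S S ℝ := .of fun s s' => M.prob s (π s) s'

lemma transMatrix_mulVec_apply (π : S → ActionVec N) (v : S → ℝ) (s : S) :
    (M.transMatrix π *ᵥ v) s = ∑ s', M.prob s (π s) s' * v s' := rfl

variable [MeasurableSpace S] [DiscreteMeasurableSpace S]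

lemma stateProb_stationary (π : S → ActionVec N) (s : S) (t : ℕ) (x : S) :
    M.stateProb (fun _ => π) s t x = (M.transMatrix π ^ t) s x := by
  induction t generalizing x with
  | zero => rw [stateProb_zero, pow_zero, one_apply]
  | succ t ih =>
    rw [stateProb_succ, pow_succ, mul_apply]
    exact Finset.sum_congr rfl fun y _ => by rw [ih]; rfl

lemma stateProb_first_action (π : S → ActionVec N) (s : S) (a : ActionVec N) (t : ℕ) (x : S) :
    M.stateProb (fun t s' => if t = 0 then a else π s') s (t + 1) x =
      ∑ y, M.prob s a y * (M.transMatrix π ^ t) y x := by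
  induction t generalizing x with
  | zero => simp [stateProb_succ, stateProb_zero, one_apply]
  | succ t ih =>
    rw [stateProb_succ]
    simp_rw [ih, pow_succ, mul_apply, Finset.mul_sum, Finset.sum_mul]
    rw [Finset.sum_comm]
    refine Finset.sum_congr rfl fun y _ => Finset.sum_congr rfl fun z _ => ?_
    simp [transMatrix, mul_assoc]

lemma hasSum_V (π : S → ActionVec N) (s : S) :
    HasSum (fun t => M.γ ^ t * (M.transMatrix π ^ t *ᵥ fun x => M.reward x (π x)) s)
      (M.V π s) := by
  -- The policy may leave `M.actions`, where rewards are arbitrary, so the uniform bound comes from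
  -- finiteness of `S`.
  have h := M.expReturn_hasSum (fun _ => π) s (B := ∑ x, |M.reward x (π x)|)
    (fun _ x => Finset.single_le_sum (f := fun x => |M.reward x (π x)|)
      (fun _ _ => abs_nonneg _) (Finset.mem_univ x))
  simp_rw [stateProb_stationary] at h
  exact h

/-- The Bellman equation for action values. -/
theorem Q_eq (π : S → ActionVec N) (s : S) (a : ActionVec N) :
    M.Q π s a = M.reward s a + M.γ * ∑ s', M.prob s a s' * M.V π s' := by
  have h := M.expReturn_hasSum (fun t s' => if t = 0 then a else π s') s
    (B := ∑ x, |M.reward x a| + ∑ x, |M.reward x (π x)|) (by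
      intro t x
      have h1 := Finset.single_le_sum (f := fun x => |M.reward x (π x)|)
        (fun _ _ => abs_nonneg _) (Finset.mem_univ x)
      have h2 := Finset.single_le_sum (f := fun x => |M.reward x a|)
        (fun _ _ => abs_nonneg _) (Finset.mem_univ x)
      have h3 := abs_nonneg (M.reward x (π x))
      have h4 := abs_nonneg (M.reward x a)
      beta_reduce at h1 h2
      split_ifs <;> linarith)
  -- Splitting off time `0` leaves the return of `π` from the successor state, discounted once.
  have h' := (hasSum_nat_add_iff' 1).2 h
  have h2 : HasSum (fun t => M.γ * ∑ s', M.prob s a s' *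
      (M.γ ^ t * (M.transMatrix π ^ t *ᵥ fun x => M.reward x (π x)) s'))
      (M.γ * ∑ s', M.prob s a s' * M.V π s') :=
    (hasSum_sum fun s' _ => (M.hasSum_V π s').mul_left _).mul_left _
  have h3 := h'.unique (a₂ := M.γ * ∑ s', M.prob s a s' * M.V π s') (by
    refine (congrArg (HasSum · _) (funext fun t => ?_)).mpr h2
    simp_rw [stateProb_first_action, mulVec, dotProduct, pow_succ', Finset.sum_mul, Finset.mul_sum]
    rw [Finset.sum_comm]
    refine Finset.sum_congr rfl fun y _ => Finset.sum_congr rfl fun z _ => ?_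
    simp only [Nat.add_eq_zero_iff, one_ne_zero, and_false, if_false]
    ring)
  simp [stateProb_zero] at h3
  rw [Q, ← h3]
  ring

/-- The Bellman equation for state values. -/
theorem V_eq (π : S → ActionVec N) (s : S) :
    M.V π s = M.reward s (π s) + M.γ * ∑ s', M.prob s (π s) s' * M.V π s' := by
  have h' := (hasSum_nat_add_iff' 1).2 (M.hasSum_V π s)
  have h2 : HasSum (fun t => M.γ * ∑ s', M.prob s (π s) s' *
      (M.γ ^ t * (M.transMatrix π ^ t *ᵥ fun x => M.reward x (π x)) s'))
      (M.γ * ∑ s', M.prob s (π s) s' * M.V π s') :=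
    (hasSum_sum fun s' _ => (M.hasSum_V π s').mul_left _).mul_left _
  have h3 := h'.unique (a₂ := M.γ * ∑ s', M.prob s (π s) s' * M.V π s') (by
    refine (congrArg (HasSum · _) (funext fun t => ?_)).mpr h2
    rw [pow_succ' (M.transMatrix π), ← mulVec_mulVec, transMatrix_mulVec_apply, pow_succ',
      mul_assoc, Finset.mul_sum]
    congr 1
    exact Finset.sum_congr rfl fun y _ => by ring)
  simp at h3
  rw [← h3]
  ring

lemma Q_self (π : S → ActionVec N) (s : S) : M.Q π s (π s) = M.V π s := by
  rw [Q_eq, V_eq]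

end Bellman

end FWPO.MDP

namespace FWPO.MDP

/-! ### Discounted occupancies and performance differences -/

section Resolvent

open Matrix

open scoped Classical

variable {S : Type*} {N : ℕ} (M : MDP S N) [Fintype S]

/-- A function that dominates its discounted expected successor value is nonnegative. -/
lemma nonneg_of_discounted_le (π : S → ActionVec N) (u : S → ℝ)
    (h : ∀ s, M.γ * ∑ s', M.prob s (π s) s' * u s' ≤ u s) (s : S) : 0 ≤ u s := by
  have hγ := M.γ_mem
  have : Nonempty S := ⟨s⟩
  -- Minimum principle: at a minimizer `m` the averaged value is at least `u m`, so `γ * u m ≤ u m`.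
  obtain ⟨m, hm⟩ := Finite.exists_min u
  have h1 : u m ≤ ∑ s', M.prob m (π m) s' * u s' := by
    calc u m = ∑ s', M.prob m (π m) s' * u m := by rw [← Finset.sum_mul, M.sum_prob, one_mul]
      _ ≤ _ := Finset.sum_le_sum fun s' _ =>
        mul_le_mul_of_nonneg_left (hm s') (M.prob_nonneg _ _ _)
  have h2 := (mul_le_mul_of_nonneg_left h1 hγ.1.le).trans (h m)
  have h3 : 0 ≤ (1 - M.γ) * u m := by linarith
  exact (nonneg_of_mul_nonneg_right h3 (by linarith [hγ.2])).trans (hm s)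

lemma det_one_sub_ne_zero (π : S → ActionVec N) :
    (1 - M.γ • M.transMatrix π).det ≠ 0 := by
  have hγ := M.γ_mem
  -- Strict diagonal dominance: with `p` the probability of staying in `k`, the off-diagonal row sum
  -- is `γ (1 - p) < 1 - γ p`.
  refine det_ne_zero_of_sum_row_lt_diag fun k => ?_
  have hk : ∀ j ∈ Finset.univ.erase k, ‖(1 - M.γ • M.transMatrix π) k j‖ =
      M.γ * M.prob k (π k) j := by
    intro j hj
    have hjk : k ≠ j := (Finset.ne_of_mem_erase hj).symm
    simp [transMatrix, one_apply_ne hjk, abs_of_pos hγ.1, abs_of_nonneg (M.prob_nonneg _ _ _)]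
  rw [Finset.sum_congr rfl hk, ← Finset.mul_sum]
  have h1 := Finset.add_sum_erase Finset.univ (M.prob k (π k)) (Finset.mem_univ k)
  rw [M.sum_prob] at h1
  have h2 : (1 - M.γ • M.transMatrix π) k k = 1 - M.γ * M.prob k (π k) k := by
    simp [transMatrix]
  rw [h2]
  refine lt_of_lt_of_le ?_ (le_abs_self _)
  nlinarith [hγ.1, hγ.2]

/-- The discounted occupancy matrix `(1 - γ P_π)⁻¹` of a policy. -/
def occ (π : S → ActionVec N) : Matrix S S ℝ := (1 - M.γ • M.transMatrix π)⁻¹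

lemma one_sub_mul_occ (π : S → ActionVec N) :
    (1 - M.γ • M.transMatrix π) * M.occ π = 1 :=
  mul_nonsing_inv _ (M.det_one_sub_ne_zero π).isUnit

lemma occ_mul_one_sub (π : S → ActionVec N) :
    M.occ π * (1 - M.γ • M.transMatrix π) = 1 :=
  nonsing_inv_mul _ (M.det_one_sub_ne_zero π).isUnit

lemma occ_apply (π : S → ActionVec N) (s s' : S) :
    M.occ π s s' = (1 : Matrix S S ℝ) s s' + M.γ * ∑ x, M.prob s (π s) x * M.occ π x s' := by
  have h := congrFun (congrFun (M.one_sub_mul_occ π) s) s'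
  rw [sub_mul, one_mul, Matrix.sub_apply, smul_mul, Matrix.smul_apply, smul_eq_mul] at h
  rw [← h, mul_apply]
  simp [transMatrix]

lemma occ_nonneg (π : S → ActionVec N) (s s' : S) : 0 ≤ M.occ π s s' := by
  refine M.nonneg_of_discounted_le π (fun x => M.occ π x s') (fun x => ?_) s
  rw [M.occ_apply π x s']
  have : 0 ≤ (1 : Matrix S S ℝ) x s' := by rw [one_apply]; split_ifs <;> simp
  linarith

lemma one_le_occ_self (π : S → ActionVec N) (s : S) : 1 ≤ M.occ π s s := by
  rw [occ_apply, one_apply_eq, le_add_iff_nonneg_right]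
  exact mul_nonneg M.γ_mem.1.le (Finset.sum_nonneg fun x _ =>
    mul_nonneg (M.prob_nonneg _ _ _) (M.occ_nonneg _ _ _))

/-- The recursion says `(1 - γ P) u = w`. It is used for values, for the constant `1 / (1 - γ)`, and
for differences of values. -/
lemma eq_occ_mulVec (π : S → ActionVec N) (u w : S → ℝ)
    (h : ∀ s, u s = w s + M.γ * ∑ s', M.prob s (π s) s' * u s') (s : S) :
    u s = ∑ s', M.occ π s s' * w s' := by
  have h1 : (1 - M.γ • M.transMatrix π) *ᵥ u = w := by
    funext s
    rw [sub_mulVec, one_mulVec, smul_mulVec, Pi.sub_apply, Pi.smul_apply, smul_eq_mul,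
      transMatrix_mulVec_apply, h s]
    rw [← h s]
    linarith [h s]
  have h2 : u = M.occ π *ᵥ w := by
    rw [← h1, mulVec_mulVec, occ_mul_one_sub, one_mulVec]
  exact congrFun h2 s

lemma sum_occ (π : S → ActionVec N) (s : S) : ∑ s', M.occ π s s' = 1 / (1 - M.γ) := by
  have hγ := M.γ_mem
  have h := M.eq_occ_mulVec π (fun _ => 1 / (1 - M.γ)) (fun _ => 1) (fun x => by
    rw [← Finset.sum_mul, M.sum_prob]
    have : 1 - M.γ ≠ 0 := by linarith [hγ.2]
    field_simp
    ring) s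
  simpa using h.symm

lemma occ_le (π : S → ActionVec N) (s s' : S) : M.occ π s s' ≤ 1 / (1 - M.γ) := by
  rw [← M.sum_occ π s]
  exact Finset.single_le_sum (fun i _ => M.occ_nonneg π s i) (Finset.mem_univ s')

/-- The resolvent identity for occupancy matrices. -/
lemma occ_sub_occ (π π' : S → ActionVec N) (s s' : S) :
    M.occ π' s s' - M.occ π s s' = ∑ x, ∑ y, M.γ * M.occ π' s x *
      (M.prob x (π' x) y - M.prob x (π x) y) * M.occ π y s' := by
  have h : M.occ π' - M.occ π =
      M.occ π' * (M.γ • (M.transMatrix π' - M.transMatrix π)) * M.occ π := by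
    -- The middle factor is the difference of the two inverted matrices, as in `A⁻¹ - B⁻¹ = A⁻¹ (B -
    -- A) B⁻¹`.
    have e : M.γ • (M.transMatrix π' - M.transMatrix π) =
        (1 - M.γ • M.transMatrix π) - (1 - M.γ • M.transMatrix π') := by
      rw [smul_sub]; abel
    rw [e, mul_sub, sub_mul, occ_mul_one_sub, mul_assoc, one_sub_mul_occ, mul_one, one_mul]
  have h1 := congrFun (congrFun h s) s'
  rw [Matrix.sub_apply] at h1
  rw [h1, mul_assoc, mul_apply]
  refine Finset.sum_congr rfl fun x _ => ?_
  rw [mul_apply, Finset.mul_sum]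
  refine Finset.sum_congr rfl fun y _ => ?_
  simp [transMatrix]
  ring

/-- The unnormalized discounted state occupancy for the initial distribution `μ`. -/
def stateOcc (μ : S → ℝ) (π : S → ActionVec N) (s : S) : ℝ := ∑ s₀, μ s₀ * M.occ π s₀ s

/-- The visit at time `0` alone contributes `μ s`. This bounds the weights of the policy gradient
from below independently of the policy. -/
lemma le_stateOcc {μ : S → ℝ} (hμ : ∀ s, 0 ≤ μ s) (π : S → ActionVec N) (s : S) :
    μ s ≤ M.stateOcc μ π s := by
  refine le_trans ?_ (Finset.single_le_sum (f := fun s₀ => μ s₀ * M.occ π s₀ s)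
    (fun i _ => mul_nonneg (hμ i) (M.occ_nonneg π i s)) (Finset.mem_univ s))
  exact le_mul_of_one_le_right (hμ s) (M.one_le_occ_self π s)

variable [MeasurableSpace S] [DiscreteMeasurableSpace S]

lemma V_eq_occ (π : S → ActionVec N) (s : S) :
    M.V π s = ∑ s', M.occ π s s' * M.reward s' (π s') :=
  M.eq_occ_mulVec π (M.V π) _ (M.V_eq π) s

lemma V_nonneg (π : S → ActionVec N) (hπ : ∀ s, π s ∈ M.actions) (s : S) : 0 ≤ M.V π s := by
  rw [V_eq_occ]
  exact Finset.sum_nonneg fun x _ => mul_nonneg (M.occ_nonneg π s x) (M.reward_mem x _ (hπ x)).1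

lemma V_le (π : S → ActionVec N) (hπ : ∀ s, π s ∈ M.actions) (s : S) :
    M.V π s ≤ 1 / (1 - M.γ) := by
  rw [V_eq_occ, ← M.sum_occ π s]
  exact Finset.sum_le_sum fun x _ => mul_le_of_le_one_right (M.occ_nonneg π s x)
    (M.reward_mem x _ (hπ x)).2

/-- The performance difference lemma. -/
theorem V_sub_V (π π' : S → ActionVec N) (s : S) :
    M.V π' s - M.V π s = ∑ s', M.occ π' s s' * (M.Q π s' (π' s') - M.V π s') := by
  -- The difference of values solves the Bellman recursion of `π'` with the advantage of `π'` over
  -- `π` as source.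
  refine M.eq_occ_mulVec π' (fun x => M.V π' x - M.V π x) _ (fun x => ?_) s
  rw [Q_eq, V_eq]
  simp_rw [mul_sub, Finset.sum_sub_distrib]
  ring

lemma J_sub_J (μ : S → ℝ) (π π' : S → ActionVec N) :
    M.J μ π' - M.J μ π = ∑ s, M.stateOcc μ π' s * (M.Q π s (π' s) - M.V π s) := by
  simp_rw [J, ← Finset.sum_sub_distrib, ← mul_sub, V_sub_V, stateOcc, Finset.mul_sum,
    Finset.sum_mul]
  rw [Finset.sum_comm]
  exact Finset.sum_congr rfl fun _ _ => Finset.sum_congr rfl fun _ _ => by ring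

end Resolvent

end FWPO.MDP

/-! ### Differentiation within a set and the quadratic lower bound -/

section Gradients

variable {F : Type*} [NormedAddCommGroup F] [InnerProductSpace ℝ F] [CompleteSpace F]

lemma HasGradientWithinAt.gradientWithin_eq {f : F → ℝ} {s : Set F} {x g : F}
    (h : HasGradientWithinAt f g s x) (hs : UniqueDiffWithinAt ℝ s x) :
    gradientWithin f s x = g := by
  rw [gradientWithin, h.hasFDerivWithinAt.fderivWithin hs, LinearIsometryEquiv.symm_apply_apply]

/-- The product of a continuous function and a differentiable function that vanishes at the point
is differentiable. -/
lemma HasFDerivWithinAt.mul_of_continuousWithinAt {E : Type*} [NormedAddCommGroup E]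
    [NormedSpace ℝ E] {f g : E → ℝ} {g' : E →L[ℝ] ℝ} {s : Set E} {x : E}
    (hg : HasFDerivWithinAt g g' s x) (hf : ContinuousWithinAt f s x) (hx : g x = 0) :
    HasFDerivWithinAt (fun y => f y * g y) (f x • g') s x := by
  -- Split off `f x * g y`; the remainder is `o(1)` times `O(y - x)`.
  have h1 : HasFDerivWithinAt (fun y => (f y - f x) * g y) (0 : E →L[ℝ] ℝ) s x := by
    refine HasFDerivWithinAt.of_isLittleO ?_
    have hO : (fun y => g y) =O[𝓝[s] x] fun y => y - x := by
      simpa [hx] using hg.isBigO_sub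
    have ho : (fun y => f y - f x) =o[𝓝[s] x] fun _ => (1 : ℝ) := by
      rw [isLittleO_one_iff]
      simpa using hf.sub_const (f x)
    have h2 := ho.mul_isBigO hO.norm_right
    simp only [one_mul] at h2
    simpa [hx] using h2.of_norm_right
  have h2 := h1.add (hg.const_mul (f x))
  refine (h2.congr_fderiv (by simp)).congr (fun y _ => ?_) ?_ <;>
    (simp only [Pi.add_apply]; ring)

/-- Quadratic lower bound for functions with Lipschitz gradient. -/
lemma FWPO.IsSmoothOn.lower_bound {L : ℝ} {f : F → ℝ} {dom X : Set F}
    (h : FWPO.IsSmoothOn L f dom X) (hX : X ⊆ dom) (hconv : Convex ℝ X) {x y : F} (hx : x ∈ X)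
    (hy : y ∈ X) :
    f x + inner ℝ (gradientWithin f dom x) (y - x) - L / 2 * ‖y - x‖ ^ 2 ≤ f y := by
  set v := y - x with hv
  have hmem : ∀ t ∈ Set.Icc (0 : ℝ) 1, x + t • v ∈ X := fun t ht =>
    hconv.add_smul_sub_mem hx hy ht
  -- `φ` is `f` along the segment minus the increment of its quadratic lower model. By
  -- Cauchy–Schwarz and the Lipschitz bound its slope is nonnegative, and `φ 0 ≤ φ 1` is the claim.
  let φ : ℝ → ℝ := fun t =>
    f (x + t • v) - t * inner ℝ (gradientWithin f dom x) v + L / 2 * t ^ 2 * ‖v‖ ^ 2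
  have hderiv : ∀ t ∈ Set.Icc (0 : ℝ) 1, HasDerivWithinAt φ
      (inner ℝ (gradientWithin f dom (x + t • v)) v - inner ℝ (gradientWithin f dom x) v
        + L * t * ‖v‖ ^ 2) (Set.Icc 0 1) t := by
    intro t ht
    have h1 := (h.1 _ (hX (hmem t ht))).hasGradientWithinAt.hasFDerivWithinAt
    have h2 : HasDerivWithinAt (fun t : ℝ => x + t • v) v (Set.Icc 0 1) t := by
      simpa using (((hasDerivAt_id t).smul_const v).const_add x).hasDerivWithinAt
    have h3 := h1.comp_hasDerivWithinAt t h2 fun t ht => hX (hmem t ht)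
    have h4 := ((hasDerivAt_id t).mul_const
      (inner ℝ (gradientWithin f dom x) v : ℝ)).hasDerivWithinAt (s := Set.Icc (0 : ℝ) 1)
    have h5 := ((((hasDerivAt_id t).pow 2).const_mul (L / 2)).mul_const
      (‖v‖ ^ 2)).hasDerivWithinAt (s := Set.Icc (0 : ℝ) 1)
    refine ((h3.sub h4).add h5).congr_deriv ?_
    rw [InnerProductSpace.toDual_apply_apply]
    simp only [id_eq, Nat.cast_ofNat, Nat.add_one_sub_one, pow_one]
    ring
  have hmono : MonotoneOn φ (Set.Icc 0 1) := by
    refine monotoneOn_of_hasDerivWithinAt_nonneg (convex_Icc 0 1)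
      (fun t ht => (hderiv t ht).continuousWithinAt)
      (fun t ht => (hderiv t (interior_subset ht)).mono interior_subset) fun t ht => ?_
    have ht' := interior_subset ht
    rw [← inner_sub_left]
    have h1 := abs_real_inner_le_norm (gradientWithin f dom (x + t • v) - gradientWithin f dom x) v
    have h2 := h.2 _ (hmem t ht') _ hx
    rw [add_sub_cancel_left, norm_smul, Real.norm_eq_abs, abs_of_nonneg ht'.1] at h2
    have h3 := mul_le_mul_of_nonneg_right h2 (norm_nonneg v)
    have h4 := neg_abs_le (inner ℝ (gradientWithin f dom (x + t • v) - gradientWithin f dom x) v)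
    nlinarith
  have := hmono (Set.left_mem_Icc.2 zero_le_one) (Set.right_mem_Icc.2 zero_le_one) zero_le_one
  simp only [φ, zero_smul, one_smul, add_zero] at this
  rw [show x + v = y by rw [hv]; abel] at this
  linarith

end Gradients

namespace FWPO.MDP

/-! ### Policy gradient theorem -/

section PolicyGradient

variable {S : Type*} {N : ℕ} {M : MDP S N} {Lr Lp Cp : ℝ}

lemma Regular.continuousWithinAt_prob (h : M.Regular Lr Lp Cp) {θ : Param S N}
    (hθ : ∀ s, θ s ∈ M.actions) (s s' : S) :
    ContinuousWithinAt (fun θ : Param S N => M.prob s (θ s) s') {θ | ∀ s, θ s ∈ M.actions} θ :=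
  ContinuousWithinAt.comp (g := fun a => M.prob s a s') (t := M.actions)
    ((h.prob_smooth s s').1.continuousOn _ (hθ s))
    (PiLp.proj (𝕜 := ℝ) 2 (fun _ : S => ActionVec N) s).continuous.continuousWithinAt
    fun _ hx => hx s

variable [Fintype S]

/-- Needed to identify `gradientWithin` of `J` with the policy gradient. -/
lemma uniqueDiffOn_param : UniqueDiffOn ℝ {θ : Param S N | ∀ s, θ s ∈ M.actions} := by
  have h1 : UniqueDiffOn ℝ (Set.univ.pi fun _ : S => M.actions) :=
    UniqueDiffOn.univ_pi fun _ => M.uniqueDiff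
  have h2 := ((PiLp.continuousLinearEquiv 2 ℝ
    (fun _ : S => ActionVec N)).uniqueDiffOn_preimage_iff).2 h1
  have e : {θ : Param S N | ∀ s, θ s ∈ M.actions} = PiLp.continuousLinearEquiv 2 ℝ
      (fun _ : S => ActionVec N) ⁻¹' Set.univ.pi fun _ : S => M.actions := by
    ext θ
    simp
  rw [e]
  exact h2

/-- Resolvent identity with both occupancy factors bounded by `1 / (1 - γ)`. It transfers
continuity, and later Lipschitz bounds, from transition probabilities to occupancies. -/
lemma abs_occ_sub_le (π π' : S → ActionVec N) (s s' : S) :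
    |M.occ π' s s' - M.occ π s s'| ≤ ∑ x, ∑ y, M.γ * (1 / (1 - M.γ)) *
      |M.prob x (π' x) y - M.prob x (π x) y| * (1 / (1 - M.γ)) := by
  have hγ := M.γ_mem
  have h0 : 0 ≤ 1 / (1 - M.γ) := by
    have : 0 < 1 - M.γ := by linarith [hγ.2]
    positivity
  rw [occ_sub_occ]
  refine (Finset.abs_sum_le_sum_abs _ _).trans (Finset.sum_le_sum fun x _ => ?_)
  refine (Finset.abs_sum_le_sum_abs _ _).trans (Finset.sum_le_sum fun y _ => ?_)
  rw [abs_mul, abs_mul, abs_mul, abs_of_pos hγ.1, abs_of_nonneg (M.occ_nonneg π' s x),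
    abs_of_nonneg (M.occ_nonneg π y s')]
  have := hγ.1.le
  gcongr
  · exact M.occ_nonneg _ _ _
  · exact M.occ_le _ _ _
  · exact M.occ_le _ _ _

lemma Regular.continuousWithinAt_occ (h : M.Regular Lr Lp Cp) {θ : Param S N}
    (hθ : ∀ s, θ s ∈ M.actions) (s s' : S) :
    ContinuousWithinAt (fun θ : Param S N => M.occ (fun x => θ x) s s')
      {θ | ∀ s, θ s ∈ M.actions} θ := by
  refine tendsto_iff_norm_sub_tendsto_zero.2 ?_
  refine squeeze_zero (fun _ => norm_nonneg _) (fun θ' => abs_occ_sub_le _ _ s s') ?_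
  rw [show (0 : ℝ) = ∑ x : S, ∑ y : S, M.γ * (1 / (1 - M.γ)) * 0 * (1 / (1 - M.γ)) by simp]
  refine tendsto_finsetSum _ fun x _ => tendsto_finsetSum _ fun y _ => ?_
  refine Tendsto.mul_const _ (Tendsto.const_mul _ ?_)
  exact tendsto_iff_norm_sub_tendsto_zero.1 (h.continuousWithinAt_prob hθ x y)

variable [MeasurableSpace S] [DiscreteMeasurableSpace S]

lemma Regular.hasGradientWithinAt_Q (h : M.Regular Lr Lp Cp) (π : S → ActionVec N) (s : S)
    {a : ActionVec N} (ha : a ∈ M.actions) :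
    HasGradientWithinAt (M.Q π s) (gradientWithin (M.reward s) M.actions a + M.γ •
      ∑ s', M.V π s' • gradientWithin (fun a => M.prob s a s') M.actions a) M.actions a := by
  have h1 := ((h.reward_smooth s).1 a ha).hasGradientWithinAt.hasFDerivWithinAt
  have h2 := fun s' => (((h.prob_smooth s s').1 a ha).hasGradientWithinAt.hasFDerivWithinAt).mul_const
    (M.V π s')
  have h3 := h1.add ((HasFDerivWithinAt.fun_sum fun s' (_ : s' ∈ Finset.univ) => h2 s').const_mul
    M.γ)
  rw [hasGradientWithinAt_iff_hasFDerivWithinAt]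
  refine (h3.congr_fderiv ?_).congr (fun y _ => M.Q_eq π s y) (M.Q_eq π s a)
  simp

lemma Regular.gradQ_eq (h : M.Regular Lr Lp Cp) (π : S → ActionVec N) (s : S)
    (ha : π s ∈ M.actions) :
    M.gradQ π s = gradientWithin (M.reward s) M.actions (π s) + M.γ •
      ∑ s', M.V π s' • gradientWithin (fun a => M.prob s a s') M.actions (π s) :=
  (h.hasGradientWithinAt_Q π s ha).gradientWithin_eq (M.uniqueDiff _ ha)

/-- The policy gradient theorem for directly parametrized policies. -/
theorem Regular.hasGradientWithinAt_J (h : M.Regular Lr Lp Cp) (μ : S → ℝ) {θ : Param S N}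
    (hθ : ∀ s, θ s ∈ M.actions) :
    HasGradientWithinAt (fun θ : Param S N => M.J μ fun s => θ s)
      (WithLp.toLp 2 fun s => M.stateOcc μ (fun x => θ x) s • M.gradQ (fun x => θ x) s)
      {θ | ∀ s, θ s ∈ M.actions} θ := by
  have hcont : ∀ s, ContinuousWithinAt (fun θ : Param S N => M.stateOcc μ (fun x => θ x) s)
      {θ | ∀ s, θ s ∈ M.actions} θ := fun s =>
    tendsto_finsetSum _ fun s₀ _ => Tendsto.const_mul _ (h.continuousWithinAt_occ hθ s₀ s)
  have hQ : ∀ s, HasFDerivWithinAt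
      (fun θ' : Param S N => M.Q (fun x => θ x) s (θ' s) - M.V (fun x => θ x) s)
      ((InnerProductSpace.toDual ℝ _ (M.gradQ (fun x => θ x) s)).comp
        (PiLp.proj (𝕜 := ℝ) 2 (fun _ : S => ActionVec N) s)) {θ | ∀ s, θ s ∈ M.actions} θ := by
    intro s
    have h1 := (h.hasGradientWithinAt_Q (fun x => θ x) s (hθ s)).hasFDerivWithinAt
    rw [← h.gradQ_eq (fun x => θ x) s (hθ s)] at h1
    exact (h1.comp (t := M.actions) θ (PiLp.proj (𝕜 := ℝ) 2
      (fun _ : S => ActionVec N) s).hasFDerivWithinAt fun x (hx : ∀ s, x s ∈ M.actions) => hx s).sub_const _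
  have h1 := (HasFDerivWithinAt.fun_sum fun s (_ : s ∈ Finset.univ) =>
    (hQ s).mul_of_continuousWithinAt (hcont s)
      (sub_eq_zero.2 (M.Q_self (fun x => θ x) s))).const_add (M.J μ fun x => θ x)
  rw [hasGradientWithinAt_iff_hasFDerivWithinAt]
  -- Expansion around `θ` by performance difference. The advantages vanish at `θ`, so the varying
  -- occupancy contributes only its value there.
  have e : ∀ θ' : Param S N, M.J μ (fun s => θ' s) = M.J μ (fun x => θ x) +
      ∑ s, M.stateOcc μ (fun x => θ' x) s *
        (M.Q (fun x => θ x) s (θ' s) - M.V (fun x => θ x) s) := fun θ' => by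
    rw [← J_sub_J]; ring
  refine (h1.congr_fderiv ?_).congr (fun y _ => e y) (e θ)
  ext v
  simp [PiLp.inner_apply, inner_smul_left]

lemma Regular.gradientWithin_J (h : M.Regular Lr Lp Cp) (μ : S → ℝ) {θ : Param S N}
    (hθ : ∀ s, θ s ∈ M.actions) :
    gradientWithin (fun θ : Param S N => M.J μ fun s => θ s) {θ | ∀ s, θ s ∈ M.actions} θ =
      WithLp.toLp 2 fun s => M.stateOcc μ (fun x => θ x) s • M.gradQ (fun x => θ x) s :=
  (h.hasGradientWithinAt_J μ hθ).gradientWithin_eq (uniqueDiffOn_param _ hθ)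

end PolicyGradient

end FWPO.MDP

/-! ### Calculus of bounded Lipschitz functions -/

/-- `f` is bounded and Lipschitz on `X`. -/
def BoundedLipschitzOn {E F : Type*} [NormedAddCommGroup E] [NormedAddCommGroup F] (f : E → F)
    (X : Set E) : Prop :=
  ∃ K, 0 ≤ K ∧ ∀ x ∈ X, ‖f x‖ ≤ K ∧ ∀ y ∈ X, ‖f x - f y‖ ≤ K * ‖x - y‖

namespace BoundedLipschitzOn

variable {E F : Type*} [NormedAddCommGroup E] [NormedAddCommGroup F] {f g : E → F} {X : Set E}

lemma of_bounds {A B : ℝ} (hA : ∀ x ∈ X, ‖f x‖ ≤ A)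
    (hB : ∀ x ∈ X, ∀ y ∈ X, ‖f x - f y‖ ≤ B * ‖x - y‖) : BoundedLipschitzOn f X :=
  ⟨max 0 (max A B), le_max_left _ _, fun x hx =>
    ⟨(hA x hx).trans (by simp), fun y hy => (hB x hx y hy).trans
      (mul_le_mul_of_nonneg_right (by simp) (norm_nonneg _))⟩⟩

lemma congr (hf : BoundedLipschitzOn f X) (h : ∀ x ∈ X, g x = f x) : BoundedLipschitzOn g X := by
  obtain ⟨K, hK, hK'⟩ := hf
  exact ⟨K, hK, fun x hx => ⟨by rw [h x hx]; exact (hK' x hx).1,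
    fun y hy => by rw [h x hx, h y hy]; exact (hK' x hx).2 y hy⟩⟩

lemma const (c : F) : BoundedLipschitzOn (fun _ : E => c) X :=
  of_bounds (A := ‖c‖) (B := 0) (by simp) (by simp)

lemma add (hf : BoundedLipschitzOn f X) (hg : BoundedLipschitzOn g X) :
    BoundedLipschitzOn (fun x => f x + g x) X := by
  obtain ⟨K, hK, hf⟩ := hf
  obtain ⟨K', hK', hg⟩ := hg
  refine of_bounds (A := K + K') (B := K + K') (fun x hx =>
    (norm_add_le _ _).trans (add_le_add (hf x hx).1 (hg x hx).1)) fun x hx y hy => ?_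
  rw [add_sub_add_comm, add_mul]
  exact (norm_add_le _ _).trans (add_le_add ((hf x hx).2 y hy) ((hg x hx).2 y hy))

lemma sum {ι : Type*} (s : Finset ι) {f : ι → E → F} (hf : ∀ i, BoundedLipschitzOn (f i) X) :
    BoundedLipschitzOn (fun x => ∑ i ∈ s, f i x) X := by
  classical
  induction s using Finset.induction_on with
  | empty => simpa using const 0
  | insert i s hi ih =>
    simp_rw [Finset.sum_insert hi]
    exact (hf i).add ih

lemma smul [NormedSpace ℝ F] {c : E → ℝ} (hc : BoundedLipschitzOn c X)
    (hf : BoundedLipschitzOn f X) : BoundedLipschitzOn (fun x => c x • f x) X := by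
  obtain ⟨K, hK, hc⟩ := hc
  obtain ⟨K', hK', hf⟩ := hf
  refine of_bounds (A := K * K') (B := K * K' + K * K') (fun x hx => ?_) fun x hx y hy => ?_
  · rw [norm_smul]
    exact mul_le_mul (hc x hx).1 (hf x hx).1 (norm_nonneg _) hK
  · rw [show c x • f x - c y • f y = c x • (f x - f y) + (c x - c y) • f y by module, add_mul]
    refine (norm_add_le _ _).trans (add_le_add ?_ ?_)
    · rw [norm_smul, mul_assoc]
      exact mul_le_mul (hc x hx).1 ((hf x hx).2 y hy) (norm_nonneg _) hK
    · rw [norm_smul, mul_right_comm]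
      exact mul_le_mul ((hc x hx).2 y hy) (hf y hy).1 (norm_nonneg _)
        (mul_nonneg hK (norm_nonneg _))

end BoundedLipschitzOn

namespace FWPO

/-! ### Bounded Lipschitz functions of the action in one state -/

section Evaluation

variable {S : Type*} [Fintype S] {N : ℕ} {C : S → Set (ActionVec N)}

lemma norm_param_sub_apply_le (θ θ' : Param S N) (s : S) : ‖θ s - θ' s‖ ≤ ‖θ - θ'‖ := by
  rw [← PiLp.sub_apply]
  exact PiLp.norm_apply_le _ s

lemma norm_param_le_sum (θ : Param S N) : ‖θ‖ ≤ ∑ s, ‖θ s‖ := by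
  rw [PiLp.norm_eq_of_L2]
  refine Real.sqrt_le_iff.2 ⟨Finset.sum_nonneg fun _ _ => norm_nonneg _, ?_⟩
  exact Finset.sum_sq_le_sq_sum_of_nonneg fun _ _ => norm_nonneg _

/-- A Lipschitz function is bounded on a compact set, and evaluation at a state is `1`-Lipschitz in
the parameter. -/
lemma boundedLipschitzOn_comp_eval {F : Type*} [NormedAddCommGroup F] {f : ActionVec N → F} {s : S}
    (hC : IsCompact (C s)) {K : ℝ} (hK : 0 ≤ K)
    (hf : ∀ a ∈ C s, ∀ b ∈ C s, ‖f a - f b‖ ≤ K * ‖a - b‖) :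
    BoundedLipschitzOn (fun θ : Param S N => f (θ s)) {θ | ∀ s, θ s ∈ C s} := by
  have hcont : ContinuousOn f (C s) := by
    refine (LipschitzOnWith.of_dist_le_mul (K := K.toNNReal) fun a ha b hb => ?_).continuousOn
    rw [dist_eq_norm, dist_eq_norm, Real.coe_toNNReal _ hK]
    exact hf a ha b hb
  obtain ⟨A, hA⟩ := hC.exists_bound_of_continuousOn hcont
  exact .of_bounds (fun θ hθ => hA _ (hθ s)) fun θ hθ θ' hθ' => (hf _ (hθ s) _ (hθ' s)).trans
    (mul_le_mul_of_nonneg_left (norm_param_sub_apply_le θ θ' s) hK)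

lemma boundedLipschitzOn_toLp {F : Param S N → S → ActionVec N} {X : Set (Param S N)}
    (h : ∀ s, BoundedLipschitzOn (fun θ => F θ s) X) :
    BoundedLipschitzOn (fun θ => (WithLp.toLp 2 (F θ) : Param S N)) X := by
  choose K hK h using h
  refine ⟨∑ s, K s, Finset.sum_nonneg fun s _ => hK s, fun θ hθ => ⟨?_, fun θ' hθ' => ?_⟩⟩
  · exact (norm_param_le_sum _).trans (Finset.sum_le_sum fun s _ => (h s θ hθ).1)
  · rw [Finset.sum_mul]
    exact (norm_param_le_sum _).trans (Finset.sum_le_sum fun s _ => (h s θ hθ).2 θ' hθ')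

lemma IsSmoothOn.boundedLipschitzOn_gradient {L : ℝ} (hL : 0 ≤ L) {f : ActionVec N → ℝ}
    {A : Set (ActionVec N)} (h : IsSmoothOn L f A A) {s : S} (hA : C s ⊆ A)
    (hC : IsCompact (C s)) :
    BoundedLipschitzOn (fun θ : Param S N => gradientWithin f A (θ s)) {θ | ∀ s, θ s ∈ C s} :=
  boundedLipschitzOn_comp_eval hC hL fun a ha b hb => h.2 a (hA ha) b (hA hb)

/-- The gradient is continuous, hence bounded on the compact set `C s`; the mean value inequality on
this convex set does the rest. -/
lemma IsSmoothOn.boundedLipschitzOn {L : ℝ} (hL : 0 ≤ L) {f : ActionVec N → ℝ}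
    {A : Set (ActionVec N)} (h : IsSmoothOn L f A A) {s : S} (hA : C s ⊆ A)
    (hC : IsCompact (C s)) (hconv : Convex ℝ (C s)) :
    BoundedLipschitzOn (fun θ : Param S N => f (θ s)) {θ | ∀ s, θ s ∈ C s} := by
  have hcont : ContinuousOn (gradientWithin f A) (C s) := by
    refine (LipschitzOnWith.of_dist_le_mul (K := L.toNNReal) fun a ha b hb => ?_).continuousOn
    rw [dist_eq_norm, dist_eq_norm, Real.coe_toNNReal _ hL]
    exact h.2 a (hA ha) b (hA hb)
  obtain ⟨K, hK⟩ := hC.exists_bound_of_continuousOn hcont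
  refine boundedLipschitzOn_comp_eval hC (le_max_left 0 K) fun a ha b hb => ?_
  refine hconv.norm_image_sub_le_of_norm_hasFDerivWithin_le (fun x hx =>
    ((h.1 x (hA hx)).hasGradientWithinAt.hasFDerivWithinAt).mono hA) (fun x hx => ?_) hb ha
  rw [LinearIsometryEquiv.norm_map]
  exact (hK x hx).trans (le_max_right _ _)

end Evaluation

namespace MDP

/-! ### A smoothness constant common to all initial distributions -/

section Smoothness

variable {S : Type*} {N : ℕ} {M : MDP S N} {Lr Lp Cp : ℝ} {C : S → Set (ActionVec N)} [Fintype S]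

lemma Regular.boundedLipschitzOn_occ (h : M.Regular Lr Lp Cp) (hCA : ∀ s, C s ⊆ M.actions)
    (hCcompact : ∀ s, IsCompact (C s)) (hCconv : ∀ s, Convex ℝ (C s)) (s s' : S) :
    BoundedLipschitzOn (fun θ : Param S N => M.occ (fun x => θ x) s s') {θ | ∀ s, θ s ∈ C s} := by
  have hγ := M.γ_mem
  have h1γ : 0 < 1 - M.γ := by linarith [hγ.2]
  have hp := fun x y => (h.prob_smooth x y).boundedLipschitzOn h.Lp_nonneg (hCA x) (hCcompact x)
    (hCconv x)
  choose K hK hp using hp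
  refine .of_bounds (A := 1 / (1 - M.γ))
    (B := ∑ x, ∑ y, M.γ * (1 / (1 - M.γ)) * K x y * (1 / (1 - M.γ))) (fun θ _ => ?_)
    fun θ hθ θ' hθ' => ?_
  · rw [Real.norm_eq_abs, abs_of_nonneg (M.occ_nonneg _ _ _)]
    exact M.occ_le _ _ _
  · refine (abs_occ_sub_le _ _ s s').trans ?_
    simp_rw [Finset.sum_mul]
    refine Finset.sum_le_sum fun x _ => Finset.sum_le_sum fun y _ => ?_
    have h1 := (hp x y θ hθ).2 θ' hθ'
    rw [Real.norm_eq_abs] at h1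
    have := hγ.1.le
    calc _ ≤ M.γ * (1 / (1 - M.γ)) * (K x y * ‖θ - θ'‖) * (1 / (1 - M.γ)) := by gcongr
      _ = _ := by ring

variable [MeasurableSpace S] [DiscreteMeasurableSpace S]

lemma Regular.boundedLipschitzOn_V (h : M.Regular Lr Lp Cp) (hCA : ∀ s, C s ⊆ M.actions)
    (hCcompact : ∀ s, IsCompact (C s)) (hCconv : ∀ s, Convex ℝ (C s)) (s : S) :
    BoundedLipschitzOn (fun θ : Param S N => M.V (fun x => θ x) s) {θ | ∀ s, θ s ∈ C s} := by
  simp_rw [V_eq_occ]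
  exact .sum _ fun x => (h.boundedLipschitzOn_occ hCA hCcompact hCconv s x).smul
    ((h.reward_smooth x).boundedLipschitzOn h.Lr_nonneg (hCA x) (hCcompact x) (hCconv x))

lemma Regular.boundedLipschitzOn_gradQ (h : M.Regular Lr Lp Cp) (hCA : ∀ s, C s ⊆ M.actions)
    (hCcompact : ∀ s, IsCompact (C s)) (hCconv : ∀ s, Convex ℝ (C s)) (s : S) :
    BoundedLipschitzOn (fun θ : Param S N => M.gradQ (fun x => θ x) s) {θ | ∀ s, θ s ∈ C s} :=
  BoundedLipschitzOn.congr
    (((h.reward_smooth s).boundedLipschitzOn_gradient h.Lr_nonneg (hCA s) (hCcompact s)).add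
      ((BoundedLipschitzOn.const M.γ).smul (.sum Finset.univ fun s' =>
        (h.boundedLipschitzOn_V hCA hCcompact hCconv s').smul
          ((h.prob_smooth s s').boundedLipschitzOn_gradient h.Lp_nonneg (hCA s) (hCcompact s)))))
    fun θ hθ => h.gradQ_eq (fun x => θ x) s (hCA s (hθ s))

/-- The performance objectives have a common smoothness constant. -/
theorem Regular.exists_JSmooth (h : M.Regular Lr Lp Cp) (hCA : ∀ s, C s ⊆ M.actions)
    (hCcompact : ∀ s, IsCompact (C s)) (hCconv : ∀ s, Convex ℝ (C s)) :
    ∃ L₀ : ℝ, 0 ≤ L₀ ∧ ∀ L, L₀ ≤ L → ∀ μ ∈ stdSimplex ℝ S, M.JSmooth C μ L := by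
  -- One constant per deterministic initial state: the gradient for `μ` is the `μ`-average of these
  -- fields, so their sum serves every `μ`.
  have hs : ∀ s₀, BoundedLipschitzOn (fun θ : Param S N =>
      (WithLp.toLp 2 fun s => M.occ (fun x => θ x) s₀ s • M.gradQ (fun x => θ x) s : Param S N))
      {θ | ∀ s, θ s ∈ C s} := fun s₀ => boundedLipschitzOn_toLp fun s =>
    (h.boundedLipschitzOn_occ hCA hCcompact hCconv s₀ s).smul
      (h.boundedLipschitzOn_gradQ hCA hCcompact hCconv s)
  choose K hK hs using hs
  refine ⟨∑ s, K s, Finset.sum_nonneg fun s _ => hK s, fun L hL μ hμ => ⟨fun θ hθ =>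
    (h.hasGradientWithinAt_J μ hθ).differentiableWithinAt, fun θ hθ θ' hθ' => ?_⟩⟩
  rw [h.gradientWithin_J μ fun s => hCA s (hθ s), h.gradientWithin_J μ fun s => hCA s (hθ' s)]
  have e : ∀ θ : Param S N,
      (WithLp.toLp 2 fun s => M.stateOcc μ (fun x => θ x) s • M.gradQ (fun x => θ x) s :
        Param S N) = ∑ s₀, μ s₀ • (WithLp.toLp 2 fun s =>
          M.occ (fun x => θ x) s₀ s • M.gradQ (fun x => θ x) s : Param S N) := by
    intro θ
    ext s i
    simp [stateOcc, Finset.sum_mul, mul_assoc]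
  rw [e, e, ← Finset.sum_sub_distrib]
  refine (norm_sum_le _ _).trans (le_trans ?_ (mul_le_mul_of_nonneg_right hL (norm_nonneg _)))
  rw [Finset.sum_mul]
  refine Finset.sum_le_sum fun s₀ _ => ?_
  rw [← smul_sub, norm_smul, Real.norm_eq_abs, abs_of_nonneg (hμ.1 s₀)]
  refine le_trans (mul_le_of_le_one_left (norm_nonneg _) ?_) ((hs s₀ θ hθ).2 θ' hθ')
  rw [← hμ.2]
  exact Finset.single_le_sum (fun i _ => hμ.1 i) (Finset.mem_univ s₀)

end Smoothness

end MDP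

end FWPO

namespace FWPO

namespace MDP

/-! ### Frank–Wolfe gaps, step sizes and feasibility -/

section FrankWolfe

variable {S : Type*} [Fintype S] [MeasurableSpace S] [DiscreteMeasurableSpace S] {N : ℕ}
  {M : MDP S N} {Lr Lp Cp : ℝ} {C : S → Set (ActionVec N)}

lemma gap_le {π c : S → ActionVec N} {s : S} (hC : IsCompact (C s)) (hπ : π s ∈ C s)
    (hc : c s ∈ C s) {K : ℝ} (hK : ‖M.gradQ π s‖ ≤ K) :
    M.gap π c s ≤ Metric.diam (C s) * K := by
  refine (real_inner_le_norm _ _).trans (mul_le_mul ?_ hK (norm_nonneg _) Metric.diam_nonneg)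
  rw [← dist_eq_norm]
  exact Metric.dist_le_diam_of_mem hC.isBounded hc hπ

lemma IsRun.gap_nonneg {μ : S → ℝ} {L : ℝ} {θ c : ℕ → S → ActionVec N} (h : M.IsRun C μ L θ c)
    {k : ℕ} {s : S} (hθ : θ k s ∈ C s) : 0 ≤ M.gap (θ k) (c k) s := by
  rw [gap, inner_sub_left]
  exact sub_nonneg.2 (h.vertex_max k s _ hθ)

end FrankWolfe

end MDP

section Distribution

variable {S : Type*} [Fintype S] {μ : S → ℝ}

lemma IsPosDistribution.iInf_le (s : S) : ⨅ s', μ s' ≤ μ s :=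
  ciInf_le (Finite.bddBelow_range μ) s

lemma IsPosDistribution.nonempty (h : IsPosDistribution μ) : Nonempty S := by
  by_contra hS
  rw [not_nonempty_iff] at hS
  simpa using h.1.2

lemma IsPosDistribution.iInf_pos (h : IsPosDistribution μ) : 0 < ⨅ s, μ s := by
  have := h.nonempty
  obtain ⟨s, hs⟩ := exists_eq_ciInf_of_finite (f := μ)
  rw [← hs]
  exact h.2 s

lemma IsPosDistribution.iInf_le_one (h : IsPosDistribution μ) : ⨅ s, μ s ≤ 1 := by
  obtain ⟨s⟩ := h.nonempty
  refine (iInf_le s).trans ?_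
  rw [← h.1.2]
  exact Finset.single_le_sum (fun i _ => h.1.1 i) (Finset.mem_univ s)

end Distribution

namespace MDP

section Feasibility

variable {S : Type*} [Fintype S] [MeasurableSpace S] [DiscreteMeasurableSpace S] {N : ℕ}
  {M : MDP S N} {Lr Lp Cp : ℝ} {C : S → Set (ActionVec N)}

lemma stepSize_nonneg {μ : S → ℝ} (hμ : IsPosDistribution μ) {L : ℝ} (hL : 0 < L)
    {π c : S → ActionVec N} {s : S} (hg : 0 ≤ M.gap π c s) : 0 ≤ M.stepSize C μ L π c s := by
  have h1 : 0 ≤ 1 - M.γ := by linarith [M.γ_mem.2]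
  have := hμ.iInf_pos.le
  unfold stepSize
  positivity

/-- By Cauchy–Schwarz the gap is at most `K` times the diameter `D`, hence at most `L * D ^ 2`; the
factors `1 - γ` and `μ_min` are at most `1`. -/
lemma stepSize_le_one {μ : S → ℝ} (hμ : IsPosDistribution μ) {L : ℝ} (hL : 0 < L)
    {π c : S → ActionVec N} {s : S} (hC : IsCompact (C s)) (hπ : π s ∈ C s) (hc : c s ∈ C s)
    (hg : 0 ≤ M.gap π c s) {K : ℝ} (hK : ‖M.gradQ π s‖ ≤ K)
    (hKL : K / Metric.diam (C s) ≤ L) : M.stepSize C μ L π c s ≤ 1 := by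
  have h1 : 0 ≤ 1 - M.γ := by linarith [M.γ_mem.2]
  have h2 : 1 - M.γ ≤ 1 := by linarith [M.γ_mem.1]
  unfold stepSize
  -- For diameter `0`, division by zero makes the step size `0`, as the algorithm prescribes.
  rcases (Metric.diam_nonneg (s := C s)).eq_or_lt with hD | hD
  · simp [← hD]
  rw [div_mul_eq_mul_div, div_le_one (by positivity)]
  rw [div_le_iff₀ hD] at hKL
  calc (1 - M.γ) * (⨅ s', μ s') * M.gap π c s ≤ 1 * 1 * M.gap π c s := by
        gcongr
        · exact hμ.iInf_pos.le
        · exact hμ.iInf_le_one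
    _ = M.gap π c s := by ring
    _ ≤ Metric.diam (C s) * K := gap_le hC hπ hc hK
    _ ≤ Metric.diam (C s) * (L * Metric.diam (C s)) := by gcongr
    _ = _ := by ring

/-- Runs with a large constant are feasible. -/
theorem Regular.exists_feasible (h : M.Regular Lr Lp Cp) (hCA : ∀ s, C s ⊆ M.actions)
    (hCcompact : ∀ s, IsCompact (C s)) (hCconv : ∀ s, Convex ℝ (C s)) :
    ∃ L₀ : ℝ, 0 ≤ L₀ ∧ ∀ L, L₀ ≤ L → 0 < L → ∀ μ : S → ℝ, IsPosDistribution μ →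
      ∀ θ c : ℕ → S → ActionVec N, M.IsRun C μ L θ c → ∀ k s, θ k s ∈ C s := by
  choose K hK hQ using fun s => h.boundedLipschitzOn_gradQ hCA hCcompact hCconv s
  have hpos : ∀ s, 0 ≤ K s / Metric.diam (C s) := fun s => div_nonneg (hK s) Metric.diam_nonneg
  -- The sum dominates each `K s / D_s`; states of diameter `0` contribute `0`.
  refine ⟨∑ s, K s / Metric.diam (C s), Finset.sum_nonneg fun s _ => hpos s, ?_⟩
  intro L hL hL0 μ hμ θ c hrun k
  induction k with
  | zero => exact hrun.init
  | succ k ih =>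
    intro s
    have hg := hrun.gap_nonneg (ih s)
    rw [hrun.update]
    refine (hCconv s).add_smul_sub_mem (ih s) (hrun.vertex_mem k s)
      ⟨stepSize_nonneg hμ hL0 hg, stepSize_le_one hμ hL0 (hCcompact s) (ih s)
        (hrun.vertex_mem k s) hg (hQ s (WithLp.toLp 2 (θ k)) ih).1 (le_trans ?_ hL)⟩
    exact Finset.single_le_sum (f := fun s => K s / Metric.diam (C s)) (fun i _ => hpos i)
      (Finset.mem_univ s)

end Feasibility

/-! ### Monotone improvement and summability of the gaps -/

section Improvement

variable {S : Type*} [Fintype S] [MeasurableSpace S] [DiscreteMeasurableSpace S] {N : ℕ}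
  {M : MDP S N} {Lr Lp Cp : ℝ} {C : S → Set (ActionVec N)}

/-- Inner product and squared norm are sums over states, so the quadratic bound separates. This
permits a different step size in each state, as well as updates of a single state. -/
lemma Regular.J_lower_bound (h : M.Regular Lr Lp Cp) (hCA : ∀ s, C s ⊆ M.actions)
    (hCconv : ∀ s, Convex ℝ (C s)) {μ : S → ℝ} {L : ℝ} (hJ : M.JSmooth C μ L)
    {π π' : S → ActionVec N} (hπ : ∀ s, π s ∈ C s) (hπ' : ∀ s, π' s ∈ C s) :
    M.J μ π + ∑ s, (M.stateOcc μ π s * inner ℝ (π' s - π s) (M.gradQ π s) -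
      L / 2 * ‖π' s - π s‖ ^ 2) ≤ M.J μ π' := by
  have hconv : Convex ℝ {θ : Param S N | ∀ s, θ s ∈ C s} := by
    intro x hx y hy a b ha hb hab s
    exact hCconv s (hx s) (hy s) ha hb hab
  have h1 := hJ.lower_bound (fun θ hθ s => hCA s (hθ s)) hconv
    (x := WithLp.toLp 2 π) (y := WithLp.toLp 2 π') hπ hπ'
  rw [h.gradientWithin_J μ fun s => hCA s (hπ s), PiLp.inner_apply, PiLp.norm_sq_eq_of_L2,
    Finset.mul_sum, add_sub_assoc, ← Finset.sum_sub_distrib] at h1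
  refine le_of_eq_of_le ?_ h1
  congr 1
  refine Finset.sum_congr rfl fun s _ => ?_
  simp [inner_smul_left, real_inner_comm]

/-- The gain guaranteed by one Frank–Wolfe step in state `s`. -/
lemma step_gain {μ : S → ℝ} (hμ : IsPosDistribution μ) {L : ℝ} (hL : 0 < L)
    {π c : S → ActionVec N} {s : S} (hC : IsCompact (C s)) (hπ : π s ∈ C s) (hc : c s ∈ C s)
    (hg : 0 ≤ M.gap π c s) {z : ActionVec N}
    (hz : z = π s + M.stepSize C μ L π c s • (c s - π s)) :
    0 ≤ M.stateOcc μ π s * inner ℝ (z - π s) (M.gradQ π s) - L / 2 * ‖z - π s‖ ^ 2 ∧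
    (1 - M.γ) * (⨅ s, μ s) ^ 2 * M.gap π c s ^ 2 ≤ 2 * L * Metric.diam (C s) ^ 2 *
      (M.stateOcc μ π s * inner ℝ (z - π s) (M.gradQ π s) - L / 2 * ‖z - π s‖ ^ 2) := by
  have hγ := M.γ_mem
  have hα := stepSize_nonneg (C := C) hμ hL hg
  have hm := hμ.iInf_pos
  have hη : ⨅ s, μ s ≤ M.stateOcc μ π s :=
    (IsPosDistribution.iInf_le s).trans (M.le_stateOcc (fun s => (hμ.2 s).le) π s)
  have hn : ‖c s - π s‖ ≤ Metric.diam (C s) := by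
    rw [← dist_eq_norm]
    exact Metric.dist_le_diam_of_mem hC.isBounded hc hπ
  have hzs : z - π s = M.stepSize C μ L π c s • (c s - π s) := by rw [hz, add_sub_cancel_left]
  rw [hzs, real_inner_smul_left, norm_smul, Real.norm_eq_abs, abs_of_nonneg hα]
  change 0 ≤ _ * (_ * M.gap π c s) - _ ∧ _ ≤ _ * (_ * (_ * M.gap π c s) - _)
  -- For diameter `0` the vertex equals the current action, and all terms vanish.
  rcases (Metric.diam_nonneg (s := C s)).eq_or_lt with hD | hD
  · have h0 : c s - π s = 0 := norm_le_zero_iff.1 (hn.trans hD.symm.le)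
    simp [gap, h0]
  set g := M.gap π c s
  set α := M.stepSize C μ L π c s with hαdef
  set m := ⨅ s, μ s
  set D := Metric.diam (C s)
  have hαD : L * D ^ 2 * α = (1 - M.γ) * m * g := by
    rw [hαdef, stepSize, ← mul_assoc, mul_div_cancel₀]
    positivity
  have h1 : m * (α * g) ≤ M.stateOcc μ π s * (α * g) :=
    mul_le_mul_of_nonneg_right hη (mul_nonneg hα hg)
  have h2 : L / 2 * (α * ‖c s - π s‖) ^ 2 ≤ L / 2 * (α * D) ^ 2 := by gcongr
  -- The choice of `α` makes the quadratic loss `(1 - γ)` times half of `m * (α * g)`, so at least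
  -- half of the guaranteed gain survives.
  have h3 : L / 2 * (α * D) ^ 2 ≤ m * (α * g) / 2 := by
    have e : L / 2 * (α * D) ^ 2 = (1 - M.γ) * (m * (α * g)) / 2 := by
      linear_combination α / 2 * hαD
    rw [e]
    have : 0 ≤ m * (α * g) := by positivity
    nlinarith [hγ.1]
  have h4 : m * (α * g) / 2 ≤
      M.stateOcc μ π s * (α * g) - L / 2 * (α * ‖c s - π s‖) ^ 2 := by linarith
  refine ⟨le_trans (by positivity) h4, ?_⟩
  calc (1 - M.γ) * m ^ 2 * g ^ 2 = 2 * L * D ^ 2 * (m * (α * g) / 2) := by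
        linear_combination (-(m * g)) * hαD
    _ ≤ _ := mul_le_mul_of_nonneg_left h4 (by positivity)

/-- Change the policy only in `s`. The lower bound shows that `J` does not decrease, while the
performance difference reduces to the advantage of `z` in `s` times an occupancy at least `μ s > 0`.
-/
lemma Regular.V_le_Q_step (h : M.Regular Lr Lp Cp) (hCA : ∀ s, C s ⊆ M.actions)
    (hCcompact : ∀ s, IsCompact (C s)) (hCconv : ∀ s, Convex ℝ (C s)) {μ : S → ℝ}
    (hμ : IsPosDistribution μ) {L : ℝ} (hL : 0 < L) (hJ : M.JSmooth C μ L)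
    {π c : S → ActionVec N} {s : S} (hπ : ∀ s, π s ∈ C s) (hc : c s ∈ C s)
    (hg : 0 ≤ M.gap π c s) {z : ActionVec N} (hzC : z ∈ C s)
    (hz : z = π s + M.stepSize C μ L π c s • (c s - π s)) : M.V π s ≤ M.Q π s z := by
  classical
  set π' := Function.update π s z with hπ'
  have hother : ∀ x, x ≠ s → π' x = π x := fun x hx => Function.update_of_ne hx _ _
  have hself : π' s = z := Function.update_self _ _ _
  have hmem : ∀ x, π' x ∈ C x := fun x => by
    rcases eq_or_ne x s with rfl | hx
    · rw [hself]; exact hzC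
    · rw [hother x hx]; exact hπ x
  have h1 := h.J_lower_bound hCA hCconv hJ hπ hmem
  rw [Finset.sum_eq_single s (fun x _ hx => by simp [hother x hx]) (by simp), hself] at h1
  have h2 := (step_gain hμ hL (hCcompact s) (hπ s) hc hg hz).1
  have h3 := M.J_sub_J μ π π'
  rw [Finset.sum_eq_single s (fun x _ hx => by rw [hother x hx, Q_self, sub_self, mul_zero])
    (by simp), hself] at h3
  have h4 : 0 < M.stateOcc μ π' s :=
    (hμ.2 s).trans_le (M.le_stateOcc (fun s => (hμ.2 s).le) π' s)
  have h5 : 0 ≤ M.stateOcc μ π' s * (M.Q π s z - M.V π s) := by linarith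
  exact sub_nonneg.1 (nonneg_of_mul_nonneg_right h5 h4)

/-- Policy improvement: nonnegative advantages are weighted by nonnegative occupancies. -/
lemma V_le_V_of_le_Q {π π' : S → ActionVec N} (h : ∀ s, M.V π s ≤ M.Q π s (π' s)) (s : S) :
    M.V π s ≤ M.V π' s := by
  rw [← sub_nonneg, V_sub_V]
  exact Finset.sum_nonneg fun x _ => mul_nonneg (M.occ_nonneg _ _ _) (sub_nonneg.2 (h x))

lemma Regular.effGap_sq_le (h : M.Regular Lr Lp Cp) (hCA : ∀ s, C s ⊆ M.actions)
    (hCcompact : ∀ s, IsCompact (C s)) (hCconv : ∀ s, Convex ℝ (C s)) {μ : S → ℝ}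
    (hμ : IsPosDistribution μ) {L : ℝ} (hL : 0 < L) (hJ : M.JSmooth C μ L)
    {θ c : ℕ → S → ActionVec N} (hrun : M.IsRun C μ L θ c) (hθ : ∀ k s, θ k s ∈ C s) (k : ℕ) :
    (1 - M.γ) * (⨅ s, μ s) ^ 2 * M.effGap (θ k) (c k) ^ 2 ≤
      2 * L * (⨆ s, Metric.diam (C s)) ^ 2 * (M.J μ (θ (k + 1)) - M.J μ (θ k)) := by
  have h1 := h.J_lower_bound hCA hCconv hJ (hθ k) (hθ (k + 1))
  rw [effGap, Real.sq_sqrt (Finset.sum_nonneg fun _ _ => sq_nonneg _)]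
  refine le_trans ?_ (mul_le_mul_of_nonneg_left (le_sub_iff_add_le'.2 h1) (by positivity))
  rw [Finset.mul_sum, Finset.mul_sum]
  refine Finset.sum_le_sum fun s _ => ?_
  obtain ⟨h2, h3⟩ := step_gain hμ hL (hCcompact s) (hθ k s) (hrun.vertex_mem k s)
    (hrun.gap_nonneg (hθ k s)) (hrun.update k s)
  -- Since the gain in each state is nonnegative, `D_s` may be enlarged to `D_max`.
  refine h3.trans (mul_le_mul_of_nonneg_right ?_ h2)
  have := le_ciSup (Finite.bddAbove_range fun s => Metric.diam (C s)) s
  have h0 : 0 ≤ Metric.diam (C s) := Metric.diam_nonneg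
  gcongr

lemma J_mem {μ : S → ℝ} (hμ : μ ∈ stdSimplex ℝ S) {π : S → ActionVec N}
    (hπ : ∀ s, π s ∈ M.actions) : 0 ≤ M.J μ π ∧ M.J μ π ≤ 1 / (1 - M.γ) := by
  refine ⟨Finset.sum_nonneg fun s _ => mul_nonneg (hμ.1 s) (M.V_nonneg π hπ s), ?_⟩
  calc M.J μ π ≤ ∑ s, μ s * (1 / (1 - M.γ)) :=
        Finset.sum_le_sum fun s _ => mul_le_mul_of_nonneg_left (M.V_le π hπ s) (hμ.1 s)
    _ = _ := by rw [← Finset.sum_mul, hμ.2, one_mul]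

lemma Regular.sum_effGap_sq_le (h : M.Regular Lr Lp Cp) (hCA : ∀ s, C s ⊆ M.actions)
    (hCcompact : ∀ s, IsCompact (C s)) (hCconv : ∀ s, Convex ℝ (C s)) {μ : S → ℝ}
    (hμ : IsPosDistribution μ) {L : ℝ} (hL : 0 < L) (hJ : M.JSmooth C μ L)
    {θ c : ℕ → S → ActionVec N} (hrun : M.IsRun C μ L θ c) (hθ : ∀ k s, θ k s ∈ C s) (n : ℕ) :
    ∑ k ∈ Finset.range n, M.effGap (θ k) (c k) ^ 2 ≤
      2 * L * (⨆ s, Metric.diam (C s)) ^ 2 / ((1 - M.γ) ^ 3 * (⨅ s, μ s) ^ 2) := by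
  have hγ := M.γ_mem
  have hβ : 0 < 1 - M.γ := by linarith [hγ.2]
  have hm := hμ.iInf_pos
  have h1 : (1 - M.γ) * (⨅ s, μ s) ^ 2 * ∑ k ∈ Finset.range n, M.effGap (θ k) (c k) ^ 2 ≤
      2 * L * (⨆ s, Metric.diam (C s)) ^ 2 * (1 / (1 - M.γ)) := by
    rw [Finset.mul_sum]
    refine (Finset.sum_le_sum fun k _ =>
      h.effGap_sq_le hCA hCcompact hCconv hμ hL hJ hrun hθ k).trans ?_
    -- The increments of `J` telescope, and `J` stays in `[0, 1 / (1 - γ)]`.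
    rw [← Finset.mul_sum, Finset.sum_range_sub (fun k => M.J μ (θ k))]
    refine mul_le_mul_of_nonneg_left ?_ (by positivity)
    have h2 := (J_mem hμ.1 fun s => hCA s (hθ n s)).2
    have h3 := (J_mem hμ.1 fun s => hCA s (hθ 0 s)).1
    linarith
  rw [le_div_iff₀ (by positivity)]
  have h2 := mul_le_mul_of_nonneg_left h1 (sq_nonneg (1 - M.γ))
  calc _ = (1 - M.γ) ^ 2 * ((1 - M.γ) * (⨅ s, μ s) ^ 2 *
        ∑ k ∈ Finset.range n, M.effGap (θ k) (c k) ^ 2) := by ring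
    _ ≤ _ := h2
    _ = (1 - M.γ) * (2 * L * (⨆ s, Metric.diam (C s)) ^ 2) := by field_simp
    -- The argument gives `(1 - γ) ^ 2` in the denominator; the stated cube is weaker by a factor `1
    -- - γ ≤ 1`.
    _ ≤ _ := mul_le_of_le_one_left (by positivity) (by linarith [hγ.1])

end Improvement

end MDP

/-! ### Rate for the running minimum -/

section RunningMinimum

lemma runMin_nonneg {G : ℕ → ℝ} (hG : ∀ k, 0 ≤ G k) (T : ℕ) : 0 ≤ runMin G T :=
  Finset.le_inf' _ _ fun k _ => hG k

lemma runMin_le_sqrt {G : ℕ → ℝ} (hG : ∀ k, 0 ≤ G k) {B : ℝ}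
    (hB : ∀ n, ∑ k ∈ Finset.range n, G k ^ 2 ≤ B) (T : ℕ) :
    runMin G T ≤ √(B / ((T : ℝ) + 1)) := by
  refine Real.le_sqrt_of_sq_le ?_
  rw [le_div_iff₀ (by positivity), mul_comm]
  refine le_trans ?_ (hB (T + 1))
  -- The squared minimum is at most each of the `T + 1` squares, hence at most their average.
  have h := Finset.card_nsmul_le_sum (Finset.range (T + 1)) (fun k => G k ^ 2) (runMin G T ^ 2)
    fun k hk => pow_le_pow_left₀ (runMin_nonneg hG T) (Finset.inf'_le _ hk) 2
  simpa using h

lemma runMin_isBigO {G : ℕ → ℝ} (hG : ∀ k, 0 ≤ G k) {B : ℝ}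
    (hB : ∀ n, ∑ k ∈ Finset.range n, G k ^ 2 ≤ B) :
    (fun T : ℕ => runMin G T) =O[atTop] (fun T : ℕ => (T : ℝ) ^ (-(1 / 2) : ℝ)) := by
  have hB0 : 0 ≤ B := by simpa using hB 0
  refine IsBigO.of_bound (√B) ?_
  filter_upwards [eventually_gt_atTop 0] with T hT
  have hT' : (0 : ℝ) < T := by exact_mod_cast hT
  rw [Real.norm_of_nonneg (runMin_nonneg hG T), Real.norm_of_nonneg (by positivity),
    Real.rpow_neg hT'.le, ← Real.sqrt_eq_rpow, ← div_eq_mul_inv, ← Real.sqrt_div hB0]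
  refine (runMin_le_sqrt hG hB T).trans (Real.sqrt_le_sqrt ?_)
  gcongr
  linarith

end RunningMinimum

end FWPO

end

theorem mainTheorem2 {S : Type*} [Fintype S] [MeasurableSpace S] [DiscreteMeasurableSpace S]
    {N : ℕ} (M : FWPO.MDP S N) (C : S → Set (FWPO.ActionVec N))
    (hCA : ∀ s, C s ⊆ M.actions) (hCcompact : ∀ s, IsCompact (C s)) (hCconv : ∀ s, Convex ℝ (C s))
    (Lr Lp Cp : ℝ) (hreg : M.Regular Lr Lp Cp) :
    -- Every large enough `L` is a smoothness constant and makes the algorithm stay feasible.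
    (∃ L₀ : ℝ, 0 < L₀ ∧ ∀ L : ℝ, L₀ ≤ L →
      (∀ μ : S → ℝ, μ ∈ stdSimplex ℝ S → M.JSmooth C μ L) ∧
      ∀ μ : S → ℝ, FWPO.IsPosDistribution μ → ∀ θ c : ℕ → S → FWPO.ActionVec N,
        M.IsRun C μ L θ c → ∀ k s, θ k s ∈ C s) ∧
    -- The convergence claims, for every smoothness constant `L` and every feasible run.
    ∀ (μ : S → ℝ) (L : ℝ), FWPO.IsPosDistribution μ → 0 < L → M.JSmooth C μ L →
      ∀ θ c : ℕ → S → FWPO.ActionVec N, M.IsRun C μ L θ c → (∀ k s, θ k s ∈ C s) →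
        (∀ k s, M.V (θ k) s ≤ M.V (θ (k + 1)) s) ∧
        Tendsto (fun k => M.effGap (θ k) (c k)) atTop (𝓝 0) ∧
        Summable (fun k => M.effGap (θ k) (c k) ^ 2) ∧
        ∑' k, M.effGap (θ k) (c k) ^ 2 ≤
          2 * L * (⨆ s, Metric.diam (C s)) ^ 2 / ((1 - M.γ) ^ 3 * (⨅ s, μ s) ^ 2) ∧
        (∀ T : ℕ, FWPO.runMin (fun k => M.effGap (θ k) (c k)) T ≤
          √(2 * L * (⨆ s, Metric.diam (C s)) ^ 2 /
            ((1 - M.γ) ^ 3 * (⨅ s, μ s) ^ 2) / ((T : ℝ) + 1))) ∧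
        (fun T : ℕ => FWPO.runMin (fun k => M.effGap (θ k) (c k)) T)
          =O[atTop] (fun T : ℕ => (T : ℝ) ^ (-(1 / 2) : ℝ)) := by
  refine ⟨?_, fun μ L hμ hL hJ θ c hrun hθ => ?_⟩
  · obtain ⟨L₁, h₁, hsmooth⟩ := hreg.exists_JSmooth hCA hCcompact hCconv
    obtain ⟨L₂, h₂, hfeas⟩ := hreg.exists_feasible hCA hCcompact hCconv
    -- Both thresholds are nonnegative, so the sum dominates each; the `1` makes it positive.
    exact ⟨L₁ + L₂ + 1, by linarith, fun L hL =>
      ⟨hsmooth L (by linarith), hfeas L (by linarith) (by linarith)⟩⟩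
  have hsum := hreg.sum_effGap_sq_le hCA hCcompact hCconv hμ hL hJ hrun hθ
  have hG : ∀ k, 0 ≤ M.effGap (θ k) (c k) := fun k => Real.sqrt_nonneg _
  have hS : Summable fun k => M.effGap (θ k) (c k) ^ 2 :=
    summable_of_sum_range_le (fun k => sq_nonneg _) hsum
  -- The single-state improvements all refer to the old policy `θ k`, so they hold together for the
  -- simultaneous update.
  refine ⟨fun k => FWPO.MDP.V_le_V_of_le_Q fun s => hreg.V_le_Q_step hCA hCcompact hCconv hμ hL hJ
    (hθ k) (hrun.vertex_mem k s) (hrun.gap_nonneg (hθ k s)) (hθ (k + 1) s) (hrun.update k s),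
    ?_, hS, Real.tsum_le_of_sum_range_le (fun k => sq_nonneg _) hsum,
    FWPO.runMin_le_sqrt hG hsum, FWPO.runMin_isBigO hG hsum⟩
  have h := hS.tendsto_atTop_zero.sqrt
  simpa [Real.sqrt_sq (hG _)] using h
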